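/- Let $(K,\nu)$ be a henselian valued field with $\operatorname{char} K=p>0$, with valuation ring $\mathcal O_K$, value group $\nu K$ and residue field $K\nu$, and extend $\nu$ to the algebraic closure $K^{\mathrm{ac}}$ (the extension is unique). An algebraic extension $(L|K,\nu)$ is called immediate if $\nu L=\nu K$ and $L\nu=K\nu$; it is called purely wild if $\nu L/\nu K$ is a $p$-group and $L\nu|K\nu$ is purely inseparable. A purely wild (respectively immediate) extension is called minimal if it is nontrivial and has no proper nontrivial subextension. Let $\theta\in K^{\mathrm{ac}}$ be such that $(K(\theta)|K,\nu)$ is a minimal purely wild extension, and suppose that the minimal polynomial of $\theta$ over $K$ (up to a nonzero constant factor) is of the form $\mathfrak A(X)-c$, where $c\in K$ and $$\mathfrak A(X)=\sum_{i=0}^{n}a_iX^{p^i}\in\mathcal O_K[X],\qquad \nu a_0=\nu a_n=0.$$ Let $\mathfrak A\nu\in K\nu[X]$ denote the reduction of $\mathfrak A$, and suppose that $K\nu$ is not $\mathfrak A\nu$-closed, that is, $\mathfrak A\nu(K\nu)\subsetneq K\nu$. Suppose in addition that $(K(\theta)|K,\nu)$ is a minimal immediate extension. Then $(K,\nu)$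 does not admit a unique maximal immediate algebraic extension: there exist two maximal immediate algebraic extensions $W_1$ and $W_2$ of $K$ inside $K^{\mathrm{ac}}$ (that is, subextensions maximal with respect to inclusion among the immediate subextensions of $K^{\mathrm{ac}}|K$) that are not isomorphic over $K$. -/

import Mathlib

open Polynomial IsLocalRing IntermediateField

/-- The restriction to `K` of a valuation `w` on an extension field `L` of `K`.  Throughout, an
extension of valued fields `(L|K, w)` is a field extension `L|K` with a valuation `w` on `L`, and
`K` carries the restriction of `w`. -/
abbrev resVal (K : Type*) {L Γ : Type*} [Field K] [Field L] [Algebra K L]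
    [LinearOrderedCommGroupWithZero Γ] (w : Valuation L Γ) : Valuation K Γ :=
  w.comap (algebraMap K L)

instance resVal_hasExtension (K : Type*) {L Γ : Type*} [Field K] [Field L] [Algebra K L]
    [LinearOrderedCommGroupWithZero Γ] (w : Valuation L Γ) :
    (resVal K w).HasExtension w :=
  ⟨Valuation.IsEquiv.refl⟩

/-- The value group of a valued field, as a subgroup of `Γˣ` (written multiplicatively). -/
abbrev valGroup {L Γ : Type*} [Field L] [LinearOrderedCommGroupWithZero Γ]
    (w : Valuation L Γ) : Subgroup Γˣ :=
  MonoidWithZeroHom.valueGroup (.ofClass w)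

/-- The residue field of a valued field. -/
abbrev resField {L Γ : Type*} [Field L] [LinearOrderedCommGroupWithZero Γ]
    (w : Valuation L Γ) : Type _ :=
  ResidueField w.valuationSubring

/-- `(L|K, w)` is immediate: the value groups of `K` and `L` coincide, and so do the residue
fields, that is, the natural embedding of residue fields is onto. -/
def IsImmediateExt (K : Type*) {L Γ : Type*} [Field K] [Field L] [Algebra K L]
    [LinearOrderedCommGroupWithZero Γ] (w : Valuation L Γ) : Prop :=
  valGroup (resVal K w) = valGroup w ∧
    Function.Bijective (algebraMap (resField (resVal K w)) (resField w))

/-- `(L|K, w)` is purely wild, where `p > 0` is the characteristic of the residue field of `K`: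
it is algebraic, the quotient of the value groups is a `p`-group, and the residue field extension
is purely inseparable. -/
def IsPurelyWildExt (p : ℕ) (K : Type*) {L Γ : Type*} [Field K] [Field L] [Algebra K L]
    [LinearOrderedCommGroupWithZero Γ] (w : Valuation L Γ) : Prop :=
  Algebra.IsAlgebraic K L ∧
    IsPGroup p (valGroup w ⧸ (valGroup (resVal K w)).subgroupOf (valGroup w)) ∧
    IsPurelyInseparable (resField (resVal K w)) (resField w)

section Subextensions

variable {K Ω Γ : Type*} [Field K] [Field Ω] [Algebra K Ω] [LinearOrderedCommGroupWithZero Γ]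

/-- `(L|K, ν)` is a minimal purely wild extension: it is purely wild and nontrivial and has no
proper nontrivial subextension (`IsAtom` in the lattice of intermediate fields). -/
def IsMinimalPurelyWild (p : ℕ) (ν : Valuation Ω Γ) (L : IntermediateField K Ω) : Prop :=
  IsPurelyWildExt p K (resVal L ν) ∧ IsAtom L

/-- `(L|K, ν)` is a minimal immediate extension: it is immediate and nontrivial and has no
proper nontrivial subextension. -/
def IsMinimalImmediate (ν : Valuation Ω Γ) (L : IntermediateField K Ω) : Prop :=
  IsImmediateExt K (resVal L ν) ∧ IsAtom L

/-- `(W|K, ν)` is a maximal immediate algebraic extension, for a subextension `W` of an algebraic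
closure `Ω` of `K`: it is maximal among the immediate subextensions of `Ω|K`. -/
def IsMaximalImmediateAlg (ν : Valuation Ω Γ) (W : IntermediateField K Ω) : Prop :=
  Maximal (fun L : IntermediateField K Ω => IsImmediateExt K (resVal L ν)) W

end Subextensions

/-- The polynomial `∑_{i ≤ n} a_i X^{p^i}`. -/
noncomputable def additivePoly {R : Type*} [CommRing R] (p n : ℕ) (a : ℕ → R) : R[X] :=
  ∑ i ∈ Finset.range (n + 1), C (a i) * X ^ p ^ i

/-- The field `k` is `f`-closed: `f(k) = k`. -/
def IsPolyClosed {k : Type*} [Field k] (f : k[X]) : Prop :=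
  Function.Surjective fun x : k => f.eval x

/-! ### Henselian fields: invariance of the valuation under finite Galois groups -/

section GaloisInvariance

variable {K N Γ : Type*} [Field K] [Field N] [Algebra K N] [LinearOrderedCommGroupWithZero Γ]

/-! Choose b in the valuation ring of K whose residue is not a value of 𝔄ν on Kν, and a root ζ of
𝔄(X) - b. By additivity, θ + ζ is a root of 𝔄(X) - (c + b). The heart of the matter is that K(θ + ζ)
is again immediate (`isImmediateExt_adjoin_add`). Zorn's lemma then gives W₁ ⊇ K(θ) and W₂ ⊇ K(θ +
ζ). A K-isomorphism between them would give η in W₁ with 𝔄(η) = c + b, hence 𝔄(η - θ) = b inside an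
immediate extension; reducing modulo the maximal ideal contradicts the choice of b
(`eval_additivePoly_ne_of_isImmediateExt`).

For immediacy: as a₀ and aₙ are units, the conjugates of ζ are integral with distinct residues.
Since K is henselian, its automorphisms respect ν (`valuation_algEquiv_le_one`). So an integral
polynomial of degree below [K(ζ):K] that is small at ζ is small at all conjugates, and its reduction
has too many roots to be nonzero. This makes the powers of ζ residually independent over K(θ), and
also over K(θ + ζ) once a degree count shows that ζ keeps its degree there. An element of K(θ + ζ)
of value one, expanded in powers of ζ over K(θ), is congruent to a polynomial in ζ over K;
independence over K(θ + ζ) identifies it with the constant term. -/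

lemma valuation_aeval_le_one (w : Valuation N Γ) {x : N} (hx : w x ≤ 1) {f : K[X]}
    (hf : ∀ i, w (algebraMap K N (f.coeff i)) ≤ 1) : w (aeval x f) ≤ 1 := by
  rw [aeval_eq_sum_range]
  refine w.map_sum_le fun i _ => ?_
  rw [Algebra.smul_def, map_mul, map_pow]
  exact mul_le_one' (hf i) (pow_le_one' hx i)

/-- A nonzero polynomial has a nonzero coefficient of maximal value. -/
lemma exists_coeff_max_valuation (v : Valuation K Γ) {f : K[X]} (hf : f ≠ 0) :
    ∃ i, f.coeff i ≠ 0 ∧ ∀ j, v (f.coeff j) ≤ v (f.coeff i) := by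
  obtain ⟨i, hi, hmax⟩ := f.support.exists_max_image (fun i => v (f.coeff i))
    (Polynomial.nonempty_support_iff.mpr hf)
  refine ⟨i, mem_support_iff.mp hi, fun j => ?_⟩
  by_cases hj : f.coeff j = 0
  · simp [hj]
  · exact hmax j (mem_support_iff.mpr hj)

/-- A Galois element of value one, all of whose other conjugates have value less than one, lies in
the henselian base field. -/
lemma mem_base_of_conj_lt_one [FiniteDimensional K N] [IsGalois K N] (w : Valuation N Γ)
    (hens : HenselianLocalRing (resVal K w).valuationSubring) {β : N} (h1 : w β = 1)
    (h2 : ∀ σ : N ≃ₐ[K] N, σ β ≠ β → w (σ β) < 1) : β ∈ (algebraMap K N).range := by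
  classical
  set f := minpoly K β with hf
  have hint : IsIntegral K β := Algebra.IsIntegral.isIntegral β
  have hmon : f.Monic := minpoly.monic hint
  set S : Finset N := (f.aroots N).toFinset with hS
  have hsplit : f.map (algebraMap K N) = ∏ r ∈ S, (X - C r) := by
    have h := (IsGalois.splits K β).eq_prod_roots_of_monic (hmon.map _)
    have hnd : (f.aroots N).Nodup := nodup_roots (Separable.map (IsGalois.separable K β))
    rw [Finset.prod_eq_multiset_prod, hS, Multiset.toFinset_val, hnd.dedup]
    exact h
  have hβS : β ∈ S := by
    rw [hS, Multiset.mem_toFinset, mem_aroots]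
    exact ⟨hmon.ne_zero, minpoly.aeval K β⟩
  have hconj : ∀ r ∈ S, r ≠ β → w r < 1 := by
    intro r hr hne
    rw [hS, Multiset.mem_toFinset, mem_aroots] at hr
    obtain ⟨σ, hσ⟩ := minpoly.exists_algEquiv_of_root (Algebra.IsAlgebraic.isAlgebraic β) hr.2
    obtain rfl : r = σ.symm β := by rw [← hσ, AlgEquiv.symm_apply_apply]
    exact h2 σ.symm hne
  have hle : ∀ r ∈ S, w r ≤ 1 := by
    intro r hr
    by_cases h : r = β
    · rw [h, h1]
    · exact (hconj r hr h).le
  have hlift : ∀ T ⊆ S, ∃ Q : w.valuationSubring[X],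
      Q.map w.valuationSubring.subtype = ∏ r ∈ T, (X - C r) := by
    intro T
    induction T using Finset.induction with
    | empty => exact fun _ => ⟨1, by simp⟩
    | insert r T hr ih =>
      intro hT
      obtain ⟨Q, hQ⟩ := ih ((Finset.subset_insert r T).trans hT)
      refine ⟨(X - C ⟨r, hle r (hT (Finset.mem_insert_self r T))⟩) * Q, ?_⟩
      rw [Finset.prod_insert hr, Polynomial.map_mul, hQ]
      simp
  obtain ⟨F, hF⟩ := hlift S subset_rfl
  obtain ⟨Q, hQ⟩ := hlift (S.erase β) (Finset.erase_subset _ _)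
  have hcoef : ∀ i, f.coeff i ∈ (resVal K w).valuationSubring := by
    intro i
    change w (algebraMap K N (f.coeff i)) ≤ 1
    rw [← coeff_map, hsplit, ← hF, coeff_map]
    exact (F.coeff i).2
  have hmem : f ∈ Polynomial.lifts (resVal K w).valuationSubring.subtype := by
    rw [Polynomial.lifts_iff_coeff_lifts]
    exact fun i => ⟨⟨_, hcoef i⟩, rfl⟩
  obtain ⟨P, hP, -, hPm⟩ := lifts_and_natDegree_eq_and_monic hmem hmon
  have heval : ∀ (R : (resVal K w).valuationSubring[X]) (a : (resVal K w).valuationSubring),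
      algebraMap K N ((R.eval a : (resVal K w).valuationSubring) : K) =
        ((R.map (resVal K w).valuationSubring.subtype).map (algebraMap K N)).eval
          (algebraMap K N (a : K)) := by
    intro R a
    rw [eval_map_algebraMap, aeval_algebraMap_apply]
    congr 1
    rw [coe_aeval_eq_eval]
    exact (eval_map_apply (resVal K w).valuationSubring.subtype a).symm
  -- The sum of the roots, which lies in K and is congruent to β. Modulo the maximal ideal, f is a
  -- power of X times X - β, so `a₀` is a simple approximate root, which Hensel's lemma lifts to K.
  set a₀ : (resVal K w).valuationSubring := ⟨- f.nextCoeff, by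
    refine neg_mem ?_
    unfold nextCoeff
    split_ifs
    · exact zero_mem _
    · exact hcoef _⟩ with ha₀
  have ha₀β : w (algebraMap K N (a₀ : K) - β) < 1 := by
    have : algebraMap K N (a₀ : K) = ∑ r ∈ S, r := by
      rw [ha₀]
      simp only [map_neg]
      rw [← nextCoeff_map (algebraMap K N).injective, hsplit,
        prod_X_sub_C_nextCoeff, neg_neg]
    rw [this, ← Finset.add_sum_erase _ _ hβS, add_sub_cancel_left]
    exact w.map_sum_lt one_ne_zero fun r hr =>
      hconj r (Finset.mem_of_mem_erase hr) (Finset.ne_of_mem_erase hr)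
  have ha₀1 : w (algebraMap K N (a₀ : K)) = 1 := by
    rw [← h1]
    refine Valuation.map_eq_of_sub_lt w ?_
    rwa [h1]
  have hfac : f.map (algebraMap K N) = (X - C β) * Q.map w.valuationSubring.subtype := by
    rw [hQ, hsplit, Finset.mul_prod_erase _ (fun r => X - C r) hβS]
  have hQ1 : ∀ R : w.valuationSubring[X],
      w ((R.map w.valuationSubring.subtype).eval (algebraMap K N (a₀ : K))) ≤ 1 := by
    intro R
    have : (R.map w.valuationSubring.subtype).eval (algebraMap K N (a₀ : K)) =
        ((R.eval ⟨algebraMap K N (a₀ : K), ha₀1.le⟩ : w.valuationSubring) : N) := by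
      exact (eval_map_apply w.valuationSubring.subtype
        (⟨algebraMap K N (a₀ : K), ha₀1.le⟩ : w.valuationSubring))
    rw [this]
    exact (R.eval _).2
  have hQu : w ((Q.map w.valuationSubring.subtype).eval (algebraMap K N (a₀ : K))) = 1 := by
    rw [hQ, eval_prod, map_prod]
    refine Finset.prod_eq_one fun r hr => ?_
    have := hconj r (Finset.mem_of_mem_erase hr) (Finset.ne_of_mem_erase hr)
    rw [eval_sub, eval_X, eval_C, Valuation.map_sub_eq_of_lt_left _ (by rwa [ha₀1]), ha₀1]
  obtain ⟨a, haroot, -⟩ := hens.is_henselian P hPm a₀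
    (by
      rw [Valuation.mem_maximalIdeal_iff]
      change w (algebraMap K N _) < 1
      rw [heval, hP, hfac, eval_mul, map_mul, hQu, mul_one]
      simpa using ha₀β)
    (by
      rw [← IsLocalRing.notMem_maximalIdeal, Valuation.mem_maximalIdeal_iff, not_lt]
      change 1 ≤ w (algebraMap K N _)
      rw [heval, ← derivative_map, hP, ← derivative_map, hfac, derivative_mul, eval_add, eval_mul,
        eval_mul, derivative_map, add_comm, Valuation.map_add_eq_of_lt_right]
      · simp [hQu]
      · have h3 : w (eval ((algebraMap K N) ↑a₀) (X - C β)) < 1 := by simpa using ha₀β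
        simpa [hQu] using mul_lt_one_of_lt_of_le h3 (hQ1 (derivative Q)))
  have hroot : f.IsRoot (a : K) := by
    rw [← hP]
    exact haroot.map (f := (resVal K w).valuationSubring.subtype)
  have hdeg := degree_eq_one_of_irreducible_of_root (minpoly.irreducible hint) hroot
  exact minpoly.mem_range_of_degree_eq_one K β hdeg

/-- If `x` is integral at `w` but `σ₀ x` is not, then some element integral at all conjugates of `w`
is a unit at `w` and not a unit at `w ∘ σ₀`. -/
lemma exists_separating_of_one_lt [Algebra.IsAlgebraic K N] (w : Valuation N Γ) {x : N}
    (hx : w x ≤ 1) (σ₀ : N ≃ₐ[K] N) (hσ₀ : 1 < w (σ₀ x)) :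
    ∃ s : N, (∀ τ : N ≃ₐ[K] N, w (τ s) ≤ 1) ∧ w s = 1 ∧ w (σ₀ s) < 1 := by
  obtain ⟨g, hg0, hgx⟩ := Algebra.IsAlgebraic.isAlgebraic (R := K) x
  obtain ⟨k, hk0, hkmax⟩ := exists_coeff_max_valuation (resVal K w) hg0
  have hwk0 : resVal K w (g.coeff k) ≠ 0 := (Valuation.ne_zero_iff _).mpr hk0
  set f : K[X] := C (g.coeff k)⁻¹ * g with hf
  have hcoef : ∀ i, w (algebraMap K N (f.coeff i)) ≤ 1 := by
    intro i
    change resVal K w (f.coeff i) ≤ 1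
    rw [hf, coeff_C_mul, map_mul, map_inv₀, inv_mul_le_iff₀ (zero_lt_iff.mpr hwk0), mul_one]
    exact hkmax i
  have hk : w (algebraMap K N (f.coeff k)) = 1 := by
    rw [hf, coeff_C_mul, inv_mul_cancel₀ hk0, map_one, map_one]
  have hfx : aeval x f = 0 := by rw [hf, map_mul, hgx, mul_zero]
  have hcoefk : ∀ k i, (divX^[k] f).coeff i = f.coeff (i + k) := by
    intro k
    induction k with
    | zero => simp
    | succ k ih =>
      intro i
      rw [Function.iterate_succ_apply', coeff_divX, ih]
      congr 1
      ring
  -- The Horner tails: c k is the sum of f_i x^(i-k) over i ≥ k. Where x is integral they are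
  -- polynomials in x; elsewhere f(x) = 0 makes them polynomials in 1/x. Hence both c k and c (k+1)
  -- * x are integral at every conjugate.
  set c : ℕ → N := fun k => aeval x (divX^[k] f) with hc
  have hrec : ∀ k, c (k + 1) * x = c k - algebraMap K N (f.coeff k) := by
    intro k
    have h := congrArg (aeval x) (divX_mul_X_add (divX^[k] f))
    rw [map_add, map_mul, aeval_X, aeval_C, hcoefk, zero_add] at h
    rw [eq_sub_iff_add_eq]
    simp only [hc, Function.iterate_succ_apply']
    exact h
  have hc0 : c 0 = 0 := hfx
  have hB : ∀ k (τ : N ≃ₐ[K] N), w (τ (c k)) ≤ 1 := by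
    intro k τ
    by_cases hτ : w (τ x) ≤ 1
    · have : τ (c k) = aeval (τ x) (divX^[k] f) := (aeval_algHom_apply τ x _).symm
      rw [this]
      exact valuation_aeval_le_one w hτ fun i => by rw [hcoefk]; exact hcoef _
    · induction k with
      | zero => simp [hc0]
      | succ k ih =>
        have h : w (τ (c (k + 1))) * w (τ x) ≤ 1 := by
          rw [← map_mul, ← map_mul, hrec, map_sub, AlgEquiv.commutes]
          exact w.map_sub_le ih (hcoef k)
        by_contra hcon
        push Not at hτ hcon
        exact absurd h (not_le.mpr (one_lt_mul_of_lt_of_le hcon hτ.le))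
  have hBx : ∀ k (τ : N ≃ₐ[K] N), w (τ (c (k + 1) * x)) ≤ 1 := by
    intro k τ
    rw [hrec, map_sub, AlgEquiv.commutes]
    exact w.map_sub_le (hB k τ) (hcoef k)
  -- Otherwise the unit coefficient f_k = c k - c (k+1) * x would have value below one.
  obtain ⟨m, hm⟩ : ∃ m, w (c m) = 1 := by
    by_contra! hcon
    have hlt : ∀ m, w (c m) < 1 := fun m => lt_of_le_of_ne (hB m AlgEquiv.refl) (hcon m)
    have h : algebraMap K N (f.coeff k) = c k - c (k + 1) * x := by rw [hrec]; ring
    have : w (algebraMap K N (f.coeff k)) < 1 := by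
      rw [h]
      refine w.map_sub_lt (hlt k) ?_
      rw [map_mul]
      exact mul_lt_one_of_lt_of_le (hlt _) hx
    exact this.ne hk
  obtain _ | m := m
  · simp [hc0] at hm
  refine ⟨c (m + 1), hB _, hm, ?_⟩
  have h := hBx m σ₀
  rw [map_mul, map_mul] at h
  by_contra! hcon
  exact absurd h (not_le.mpr (one_lt_mul_of_le_of_lt hcon hσ₀))

/-- If σ moved the valuation ring, one could build an element fixed by the decomposition group, a
unit at w, and small at all its other conjugates. Such an element lies in K, yet σ would change its
value. -/
lemma valuation_galois_le_one [FiniteDimensional K N] [IsGalois K N] (w : Valuation N Γ)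
    (hens : HenselianLocalRing (resVal K w).valuationSubring) (σ : N ≃ₐ[K] N) {x : N}
    (hx : w x ≤ 1) : w (σ x) ≤ 1 := by
  classical
  by_contra! hσ
  obtain ⟨s, hsB, hs1, hsσ⟩ := exists_separating_of_one_lt w hx σ hσ
  let S : N → Finset (N ≃ₐ[K] N) := fun y => Finset.univ.filter fun τ => w (τ y) = 1
  have hmemS : ∀ y τ, τ ∈ S y ↔ w (τ y) = 1 := fun y τ => by simp [S]
  have hSmul : ∀ y z : N, (∀ τ : N ≃ₐ[K] N, w (τ y) ≤ 1) → (∀ τ : N ≃ₐ[K] N, w (τ z) ≤ 1) →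
      ∀ τ, τ ∈ S (y * z) → τ ∈ S y ∧ τ ∈ S z := by
    intro y z hy hz τ hτ
    rw [hmemS, map_mul, map_mul] at hτ
    rw [hmemS, hmemS]
    constructor
    · refine le_antisymm (hy τ) (not_lt.mp fun h => ?_)
      exact (mul_lt_one_of_lt_of_le h (hz τ)).ne hτ
    · refine le_antisymm (hz τ) (not_lt.mp fun h => ?_)
      rw [mul_comm] at hτ
      exact (mul_lt_one_of_lt_of_le h (hy τ)).ne hτ
  let Y : Set N := {y | (∀ τ : N ≃ₐ[K] N, w (τ y) ≤ 1) ∧ w y = 1}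
  -- With S y as small as possible, multiplying y by any z in Y cannot shrink it, so S y lies in
  -- every S z. It plays the role of the decomposition group of w.
  obtain ⟨y, hyY, hymin⟩ : ∃ y ∈ Y, ∀ z ∈ Y, (S y).card ≤ (S z).card := by
    obtain ⟨y, hy, hmin⟩ := WellFounded.has_min (measure fun y => (S y).card).wf Y ⟨s, hsB, hs1⟩
    exact ⟨y, hy, fun z hz => not_lt.mp (hmin z hz)⟩
  have hmulY : ∀ z ∈ Y, y * z ∈ Y := fun z hz =>
    ⟨fun τ => by rw [map_mul, map_mul]; exact mul_le_one' (hyY.1 τ) (hz.1 τ),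
      by rw [map_mul, hyY.2, hz.2, mul_one]⟩
  have hsub : ∀ z ∈ Y, S y ⊆ S z := by
    intro z hz
    have hle : S (y * z) ⊆ S y := fun τ hτ => (hSmul y z hyY.1 hz.1 τ hτ).1
    have heq := Finset.eq_of_subset_of_card_le hle (hymin _ (hmulY z hz))
    intro τ hτ
    rw [← heq] at hτ
    exact (hSmul y z hyY.1 hz.1 τ hτ).2
  have hσS : σ ∉ S y := fun h => by
    have := hsub s ⟨hsB, hs1⟩ h
    rw [hmemS] at this
    exact hsσ.ne this
  have hconjmem : ∀ τ ρ : N ≃ₐ[K] N, ρ ∈ S (τ y) ↔ ρ * τ ∈ S y := fun τ ρ => by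
    rw [hmemS, hmemS]; rfl
  have hstab : ∀ τ ∈ S y, ∀ ρ, ρ ∈ S y ↔ ρ * τ ∈ S y := by
    intro τ hτ ρ
    have hz : τ y ∈ Y := ⟨fun ρ => hyY.1 (ρ * τ), (hmemS y τ).mp hτ⟩
    have hcard : (S (τ y)).card ≤ (S y).card :=
      Finset.card_le_card_of_injOn (fun ρ => ρ * τ) (fun ρ hρ => (hconjmem τ ρ).mp hρ)
        (fun a _ b _ h => mul_right_cancel h)
    rw [← hconjmem, Finset.eq_of_subset_of_card_le (hsub _ hz) hcard]
  -- The norm of y along S y, which is closed under multiplication; for ρ outside S y, the factor ρ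
  -- y makes ρ β small.
  set β : N := ∏ τ ∈ S y, τ y with hβ
  have hβσ : ∀ ρ : N ≃ₐ[K] N, ρ β = ∏ τ ∈ S y, (ρ * τ) y := fun ρ => by
    rw [hβ, map_prod]; rfl
  have hfix : ∀ ρ ∈ S y, ρ β = β := by
    intro ρ hρ
    rw [hβσ, hβ]
    have himg : (S y).image (fun τ => ρ * τ) = S y := by
      refine Finset.eq_of_subset_of_card_le ?_ ?_
      · intro τ hτ
        obtain ⟨τ', hτ', rfl⟩ := Finset.mem_image.mp hτ
        exact (hstab τ' hτ' ρ).mp hρ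
      · rw [Finset.card_image_of_injective _ (mul_right_injective ρ)]
    conv_rhs => rw [← himg]
    rw [Finset.prod_image fun a _ b _ h => mul_left_cancel h]
  have hβ1 : w β = 1 := by
    rw [hβ, map_prod]
    exact Finset.prod_eq_one fun τ hτ => (hmemS y τ).mp hτ
  have hone : (1 : N ≃ₐ[K] N) ∈ S y := (hmemS y 1).mpr hyY.2
  have hlt : ∀ ρ, ρ ∉ S y → w (ρ β) < 1 := by
    intro ρ hρ
    rw [hβσ, map_prod, ← Finset.mul_prod_erase _ _ hone]
    refine mul_lt_one_of_lt_of_le ?_ (Finset.prod_le_one' fun τ _ => hyY.1 _)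
    exact lt_of_le_of_ne (hyY.1 _) fun h => hρ (by rw [hmemS]; simpa using h)
  obtain ⟨b, hb⟩ := mem_base_of_conj_lt_one w hens hβ1 fun ρ hρ =>
    hlt ρ fun h => hρ (hfix ρ h)
  have := hlt σ hσS
  rw [← hb, AlgEquiv.commutes, hb] at this
  exact this.ne hβ1

end GaloisInvariance

/-! ### Invariance of the valuation on the algebraic closure -/

section Subextension

variable {K Ω Γ : Type*} [Field K] [Field Ω] [Algebra K Ω] [LinearOrderedCommGroupWithZero Γ]

lemma resVal_resVal (ν : Valuation Ω Γ) (E : IntermediateField K Ω) :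
    resVal K (resVal E ν) = resVal K ν := rfl

/-- A henselian valuation has a unique extension to the algebraic closure. -/
lemma valuation_algEquiv_le_one [IsAlgClosure K Ω] (ν : Valuation Ω Γ)
    (hens : HenselianLocalRing (resVal K ν).valuationSubring) (σ : Ω ≃ₐ[K] Ω) {x : Ω}
    (hx : ν x ≤ 1) : ν (σ x) ≤ 1 := by
  have : IsAlgClosed Ω := IsAlgClosure.isAlgClosed K
  have : Algebra.IsAlgebraic K Ω := IsAlgClosure.isAlgebraic
  have : Normal K Ω := normal_iff.mpr fun x =>
    ⟨Algebra.IsIntegral.isIntegral x, IsAlgClosed.splits _⟩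
  -- A power of x to an exponent ringExpChar^m is separable over K, and integrality can be tested on
  -- it; this reduces to a finite Galois extension.
  obtain ⟨m, y, hy⟩ := IsPurelyInseparable.pow_mem (separableClosure K Ω) (ringExpChar K) x
  rw [IntermediateField.algebraMap_apply] at hy
  set z : Ω := x ^ ringExpChar K ^ m with hz
  have hzsep : IsSeparable K z := by
    rw [← mem_separableClosure_iff, ← hy]; exact y.2
  let N : IntermediateField K Ω := normalClosure K K⟮z⟯ Ω
  have : FiniteDimensional K K⟮z⟯ := adjoin.finiteDimensional (Algebra.IsIntegral.isIntegral z)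
  have : Algebra.IsSeparable K K⟮z⟯ := (isSeparable_adjoin_simple_iff_isSeparable K Ω).mpr hzsep
  have : Algebra.IsSeparable K N := (le_separableClosure_iff K Ω N).mp <|
    normalClosure_le_iff.mpr fun i =>
      have : Algebra.IsSeparable K i.fieldRange :=
        AlgEquiv.Algebra.isSeparable (AlgEquiv.ofInjectiveField i)
      le_separableClosure K Ω _
  have : IsGalois K N := ⟨⟩
  have hzN : z ∈ N := by
    have : K⟮z⟯ ≤ N := IntermediateField.le_normalClosure _
    exact this (mem_adjoin_simple_self K z)
  have h := valuation_galois_le_one (resVal N ν) (resVal_resVal ν N ▸ hens) (σ.restrictNormal N)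
    (x := ⟨z, hzN⟩) (by
      change ν z ≤ 1
      rw [hz, map_pow]
      exact pow_le_one' hx _)
  have h' : ν (σ z) ≤ 1 := by
    have e := AlgEquiv.restrictNormal_commutes σ N ⟨z, hzN⟩
    change ν (algebraMap N Ω _) ≤ 1 at h
    rw [e] at h
    exact h
  rw [hz, map_pow, map_pow] at h'
  exact (pow_le_one_iff (pow_ne_zero _ (expChar_pos K _).ne')).mp h'

lemma valuation_algEquiv_lt_one [IsAlgClosure K Ω] (ν : Valuation Ω Γ)
    (hens : HenselianLocalRing (resVal K ν).valuationSubring) (σ : Ω ≃ₐ[K] Ω) {x : Ω}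
    (hx : ν x < 1) : ν (σ x) < 1 := by
  by_contra! h
  have h1 : ν (σ x⁻¹) ≤ 1 := by
    rw [map_inv₀, map_inv₀]; exact inv_le_one_of_one_le₀ h
  have h2 := valuation_algEquiv_le_one ν hens σ.symm h1
  rw [AlgEquiv.symm_apply_apply, map_inv₀] at h2
  have h0 : ν x ≠ 0 := by
    intro h0
    rw [Valuation.zero_iff] at h0
    simp [h0] at h
  exact absurd h2 (not_le.mpr ((one_lt_inv₀ (zero_lt_iff.mpr h0)).mpr hx))

end Subextension

/-! ### An elementwise criterion for immediacy -/

section Immediate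

variable {K L Γ : Type*} [Field K] [Field L] [Algebra K L] [LinearOrderedCommGroupWithZero Γ]

lemma mem_valGroup_iff (w : Valuation L Γ) (u : Γˣ) : u ∈ valGroup w ↔ ∃ y, w y = u := by
  rw [← SetLike.mem_coe, ← MonoidWithZeroHom.valueMonoid_eq_valueGroup']
  exact Iff.rfl

/-- An extension is immediate if and only if every nonzero element is approximated by an element
of the base field up to an error of smaller value. -/
lemma isImmediateExt_iff (w : Valuation L Γ) :
    IsImmediateExt K w ↔ ∀ y : L, y ≠ 0 → ∃ k : K, w (y - algebraMap K L k) < w y := by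
  constructor
  · rintro ⟨hgrp, -, hsurj⟩ y hy
    have hwy : w y ≠ 0 := (Valuation.ne_zero_iff w).mpr hy
    have hu : Units.mk0 (w y) hwy ∈ valGroup (resVal K w) := by
      rw [hgrp, mem_valGroup_iff]
      exact ⟨y, rfl⟩
    obtain ⟨k, hk⟩ := (mem_valGroup_iff _ _).mp hu
    replace hk : w (algebraMap K L k) = w y := hk
    have hk0 : algebraMap K L k ≠ 0 := by
      rw [← Valuation.ne_zero_iff w, hk]; exact hwy
    have hyk : w (y / algebraMap K L k) = 1 := by rw [map_div₀, hk, div_self hwy]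
    obtain ⟨r, hr⟩ := hsurj (residue _ ⟨y / algebraMap K L k, hyk.le⟩)
    obtain ⟨x, rfl⟩ := residue_surjective r
    rw [Valuation.HasExtension.algebraMap_residue_eq_residue_algebraMap, eq_comm, ← sub_eq_zero,
      ← map_sub, residue_eq_zero_iff, Valuation.mem_maximalIdeal_iff] at hr
    replace hr : w (y / algebraMap K L k - algebraMap K L (x : K)) < 1 := hr
    refine ⟨k * x, ?_⟩
    have e : y - algebraMap K L (k * x) =
        algebraMap K L k * (y / algebraMap K L k - algebraMap K L (x : K)) := by
      rw [map_mul, mul_sub, mul_div_cancel₀ _ hk0]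
    rw [e, map_mul, hk]
    exact mul_lt_of_lt_one_right (zero_lt_iff.mpr hwy) hr
  · intro h
    refine ⟨?_, RingHom.injective _, ?_⟩
    · ext u
      rw [mem_valGroup_iff, mem_valGroup_iff]
      constructor
      · rintro ⟨k, hk⟩
        exact ⟨algebraMap K L k, hk⟩
      · rintro ⟨y, hy⟩
        have hy0 : y ≠ 0 := by
          rw [← Valuation.ne_zero_iff w, hy]; exact u.ne_zero
        obtain ⟨k, hk⟩ := h y hy0
        rw [Valuation.map_sub_swap] at hk
        exact ⟨k, (w.map_eq_of_sub_lt hk).trans hy⟩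
    · intro r
      obtain ⟨y, rfl⟩ := residue_surjective r
      by_cases hy : (y : L) = 0
      · refine ⟨0, ?_⟩
        have : y = 0 := Subtype.ext hy
        rw [this, map_zero, map_zero]
      obtain ⟨k, hk⟩ := h y hy
      have hk1 : w (algebraMap K L k) ≤ 1 := by
        rw [Valuation.map_sub_swap] at hk
        rw [w.map_eq_of_sub_lt hk]
        exact y.2
      refine ⟨residue _ ⟨k, hk1⟩, ?_⟩
      rw [Valuation.HasExtension.algebraMap_residue_eq_residue_algebraMap, eq_comm, ← sub_eq_zero,
        ← map_sub, residue_eq_zero_iff, Valuation.mem_maximalIdeal_iff]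
      exact hk.trans_le y.2

end Immediate

/-! ### Existence of maximal immediate extensions -/

section Subextension

variable {K Ω Γ : Type*} [Field K] [Field Ω] [Algebra K Ω] [LinearOrderedCommGroupWithZero Γ]

lemma isImmediateExt_intermediateField_iff (ν : Valuation Ω Γ) (E : IntermediateField K Ω) :
    IsImmediateExt K (resVal E ν) ↔
      ∀ y ∈ E, y ≠ 0 → ∃ k : K, ν (y - algebraMap K Ω k) < ν y := by
  rw [isImmediateExt_iff]
  constructor
  · intro h y hy hy0
    exact h ⟨y, hy⟩ fun h0 => hy0 (congrArg Subtype.val h0)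
  · intro h y hy0
    exact h y y.2 fun h0 => hy0 (Subtype.ext h0)

/-- Zorn's lemma applies because the approximation criterion concerns one element at a time, so it
passes to unions of chains. -/
lemma exists_isMaximalImmediateAlg_ge (ν : Valuation Ω Γ) (E : IntermediateField K Ω)
    (hE : IsImmediateExt K (resVal E ν)) :
    ∃ W : IntermediateField K Ω, E ≤ W ∧ IsMaximalImmediateAlg ν W := by
  refine zorn_le_nonempty₀ {L : IntermediateField K Ω | IsImmediateExt K (resVal L ν)}
    (fun c hc hchain F hF => ?_) E hE
  refine ⟨sSup c, ?_, fun L hL => le_sSup hL⟩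
  change IsImmediateExt K (resVal (sSup c : IntermediateField K Ω) ν)
  rw [isImmediateExt_intermediateField_iff]
  intro y hy hy0
  have : Nonempty c := ⟨⟨F, hF⟩⟩
  have hdir : Directed (· ≤ ·) (fun L : c => (L : IntermediateField K Ω)) :=
    hchain.directedOn.directed_val
  rw [sSup_eq_iSup', ← SetLike.mem_coe, IntermediateField.coe_iSup_of_directed hdir,
    Set.mem_iUnion] at hy
  obtain ⟨L, hyL⟩ := hy
  exact (isImmediateExt_intermediateField_iff ν L.1).mp (hc L.2) y hyL hy0

end Subextension

/-! ### Residual independence of the powers of ζ, and immediacy of K(θ + ζ) -/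

section ResidualRoots

variable {K Ω Γ : Type*} [Field K] [Field Ω] [Algebra K Ω] [LinearOrderedCommGroupWithZero Γ]

/-- An integral polynomial whose reduction has more roots than its degree reduces to zero. -/
lemma coeff_lt_one_of_card_roots (ν : Valuation Ω Γ) {g : Polynomial Ω} (hg : ∀ i, ν (g.coeff i) ≤ 1)
    (S : Finset Ω) (hcard : g.natDegree < S.card) (hS : ∀ r ∈ S, ν r ≤ 1)
    (hne : ∀ r ∈ S, ∀ s ∈ S, r ≠ s → 1 ≤ ν (r - s)) (heval : ∀ r ∈ S, ν (g.eval r) < 1) (i : ℕ) :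
    ν (g.coeff i) < 1 := by
  have hmem : g ∈ Polynomial.lifts ν.valuationSubring.subtype := by
    rw [Polynomial.lifts_iff_coeff_lifts]
    exact fun i => ⟨⟨_, hg i⟩, rfl⟩
  obtain ⟨G, hG, hGdeg⟩ := exists_natDegree_eq_of_mem_lifts hmem
  have hzero : G.map (residue ν.valuationSubring) = 0 := by
    refine eq_zero_of_natDegree_lt_card_of_eval_eq_zero _
      (f := fun r : S => residue ν.valuationSubring ⟨r, hS r r.2⟩) ?_ ?_ ?_
    · intro r s hrs
      by_contra hcon
      have h := hne r r.2 s s.2 fun h => hcon (Subtype.ext h)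
      dsimp only at hrs
      rw [← sub_eq_zero, ← map_sub, residue_eq_zero_iff, Valuation.mem_maximalIdeal_iff] at hrs
      exact absurd hrs (not_lt.mpr h)
    · intro r
      rw [eval_map_apply, residue_eq_zero_iff, Valuation.mem_maximalIdeal_iff]
      have h := heval r r.2
      rw [← hG] at h
      rwa [show (r : Ω) = ν.valuationSubring.subtype ⟨r, hS r r.2⟩ from rfl, eval_map_apply] at h
    · rw [Fintype.card_coe]
      exact (natDegree_map_le.trans hGdeg.le).trans_lt hcard
  have h := congrArg (fun P => P.coeff i) hzero
  simp only [coeff_map, coeff_zero] at h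
  rw [residue_eq_zero_iff, Valuation.mem_maximalIdeal_iff] at h
  rwa [← hG, coeff_map]

/-- The element `ζ` is integral and separable over `K`, and its conjugates have distinct
residues. -/
structure HasDistinctResidues (K : Type*) {Ω Γ : Type*} [Field K] [Field Ω] [Algebra K Ω]
    [LinearOrderedCommGroupWithZero Γ] (ν : Valuation Ω Γ) (ζ : Ω) : Prop where
  separable : IsSeparable K ζ
  le_one : ∀ r, aeval r (minpoly K ζ) = 0 → ν r ≤ 1
  one_le_sub : ∀ r s, aeval r (minpoly K ζ) = 0 → aeval s (minpoly K ζ) = 0 → r ≠ s → 1 ≤ ν (r - s)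

variable {ν : Valuation Ω Γ} {F : IntermediateField K Ω}

lemma exists_integral_approx (hF : IsImmediateExt K (resVal F ν)) (y : F) (hy : ν y ≤ 1) :
    ∃ k : K, ν (algebraMap K Ω k) ≤ 1 ∧ ν (y - algebraMap K Ω k) < 1 := by
  by_cases hy0 : (y : Ω) = 0
  · exact ⟨0, by simp, by simp [hy0]⟩
  obtain ⟨k, hk⟩ := (isImmediateExt_intermediateField_iff ν F).mp hF y y.2 hy0
  have hk' := hk
  rw [Valuation.map_sub_swap] at hk'
  exact ⟨k, (ν.map_eq_of_sub_lt hk').trans_le hy, hk.trans_le hy⟩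

/-- Integral polynomials over an immediate extension are congruent to integral polynomials over the
base field. -/
lemma exists_polynomial_approx (hF : IsImmediateExt K (resVal F ν)) {g : F[X]}
    (hg : ∀ i, ν (g.coeff i) ≤ 1) :
    ∃ h : K[X], h.natDegree ≤ g.natDegree ∧ (∀ i, ν (algebraMap K Ω (h.coeff i)) ≤ 1) ∧
      ∀ i, ν (g.coeff i - algebraMap K Ω (h.coeff i)) < 1 := by
  choose k hk1 hk using fun i => exists_integral_approx hF (g.coeff i) (hg i)
  refine ⟨∑ i ∈ Finset.range (g.natDegree + 1), monomial i (k i), ?_, ?_⟩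
  · refine natDegree_sum_le_of_forall_le _ _ fun i hi => ?_
    exact (natDegree_monomial_le _).trans (Nat.lt_succ_iff.mp (Finset.mem_range.mp hi))
  · have hco : ∀ i, (∑ i ∈ Finset.range (g.natDegree + 1), monomial i (k i)).coeff i =
        if i < g.natDegree + 1 then k i else 0 := by
      intro i
      rw [finsetSum_coeff]
      simp [coeff_monomial]
    refine ⟨fun i => ?_, fun i => ?_⟩
    · rw [hco]
      split_ifs
      · exact hk1 i
      · simp
    · rw [hco]
      split_ifs with hi
      · exact hk i
      · rw [coeff_eq_zero_of_natDegree_lt (by omega)]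
        simp

lemma valuation_aeval_sub_lt_one {ζ : Ω} (hζ : ν ζ ≤ 1) {g : F[X]} {h : K[X]}
    (hgh : ∀ i, ν (g.coeff i - algebraMap K Ω (h.coeff i)) < 1) :
    ν (aeval ζ g - aeval ζ h) < 1 := by
  have e : aeval ζ g - aeval ζ h = aeval ζ (g - h.map (algebraMap K F)) := by
    rw [map_sub, aeval_map_algebraMap]
  rw [e, aeval_eq_sum_range]
  refine ν.map_sum_lt one_ne_zero fun i _ => ?_
  rw [Algebra.smul_def, map_mul, map_pow]
  refine mul_lt_one_of_lt_of_le ?_ (pow_le_one' hζ i)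
  rw [coeff_sub, coeff_map, map_sub, ← IsScalarTower.algebraMap_apply]
  exact hgh i

variable [IsAlgClosure K Ω]

/-- If the conjugates of `ζ` over `K` remain conjugate over `E`, then the powers of `ζ` have
residues independent over the residue field of `E`. -/
lemma coeff_lt_one_of_natDegree_minpoly_eq {ζ : Ω}
    (hens : HenselianLocalRing (resVal K ν).valuationSubring) (hζ : HasDistinctResidues K ν ζ)
    {E : Type*} [Field E] [Algebra K E] [Algebra E Ω] [IsScalarTower K E Ω]
    (hdeg : (minpoly E ζ).natDegree = (minpoly K ζ).natDegree) {g : E[X]}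
    (hgdeg : g.natDegree < (minpoly K ζ).natDegree) (hg : ∀ i, ν (algebraMap E Ω (g.coeff i)) ≤ 1)
    (hgζ : ν (aeval ζ g) < 1) (i : ℕ) : ν (algebraMap E Ω (g.coeff i)) < 1 := by
  classical
  have : IsAlgClosed Ω := IsAlgClosure.isAlgClosed K
  have : Algebra.IsAlgebraic K Ω := IsAlgClosure.isAlgebraic
  have : Algebra.IsAlgebraic E Ω := Algebra.IsAlgebraic.tower_top (K := K) E
  have : Normal E Ω := normal_iff.mpr fun x =>
    ⟨Algebra.IsIntegral.isIntegral x, IsAlgClosed.splits _⟩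
  have hint : IsIntegral K ζ := Algebra.IsIntegral.isIntegral ζ
  have heq : minpoly E ζ = (minpoly K ζ).map (algebraMap K E) := by
    refine (Polynomial.eq_of_monic_of_dvd_of_natDegree_le (minpoly.monic hint.tower_top)
      ((minpoly.monic hint).map _) (minpoly.dvd_map_of_isScalarTower K E ζ) ?_).symm
    rw [natDegree_map, hdeg]
  rw [← coeff_map]
  refine coeff_lt_one_of_card_roots ν (S := ((minpoly K ζ).aroots Ω).toFinset)
    (fun i => by rw [coeff_map]; exact hg i) ?_ ?_ ?_ ?_ i
  · have hnd : ((minpoly K ζ).aroots Ω).Nodup := nodup_roots (Separable.map hζ.separable)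
    rw [natDegree_map, Multiset.toFinset_card_of_nodup hnd,
      ← (IsAlgClosed.splits ((minpoly K ζ).map (algebraMap K Ω))).natDegree_eq_card_roots,
      natDegree_map]
    exact hgdeg
  · intro r hr
    rw [Multiset.mem_toFinset, mem_aroots] at hr
    exact hζ.le_one r hr.2
  · intro r hr s hs
    rw [Multiset.mem_toFinset, mem_aroots] at hr hs
    exact hζ.one_le_sub r s hr.2 hs.2
  · intro r hr
    rw [Multiset.mem_toFinset, mem_aroots] at hr
    have hrE : aeval r (minpoly E ζ) = 0 := by rw [heq, aeval_map_algebraMap]; exact hr.2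
    -- Automorphisms over E fix the coefficients of g and preserve smallness, so g is small at every
    -- conjugate of ζ.
    obtain ⟨σ, hσ⟩ := minpoly.exists_algEquiv_of_root (Algebra.IsAlgebraic.isAlgebraic ζ) hrE
    obtain rfl : r = σ.symm ζ := by rw [← hσ, AlgEquiv.symm_apply_apply]
    have e : aeval (σ.symm ζ) g = σ.symm (aeval ζ g) := aeval_algHom_apply σ.symm ζ g
    rw [eval_map_algebraMap, e]
    exact valuation_algEquiv_lt_one ν hens (σ.symm.restrictScalars K) hgζ

/-- Immediacy allows the coefficients to be replaced by congruent ones from K, where the degree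
hypothesis is trivial. -/
lemma coeff_lt_one_of_isImmediateExt {ζ : Ω}
    (hens : HenselianLocalRing (resVal K ν).valuationSubring) (hζ : HasDistinctResidues K ν ζ)
    (hF : IsImmediateExt K (resVal F ν)) {g : F[X]}
    (hgdeg : g.natDegree < (minpoly K ζ).natDegree) (hg : ∀ i, ν (g.coeff i) ≤ 1)
    (hgζ : ν (aeval ζ g) < 1) (i : ℕ) : ν (g.coeff i) < 1 := by
  obtain ⟨h, hdeg, hh1, hh⟩ := exists_polynomial_approx hF hg
  have hζ1 : ν ζ ≤ 1 := hζ.le_one ζ (minpoly.aeval K ζ)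
  have hhζ : ν (aeval ζ h) < 1 := by
    have e : aeval ζ h = aeval ζ g - (aeval ζ g - aeval ζ h) := by ring
    rw [e]
    exact ν.map_sub_lt hgζ (valuation_aeval_sub_lt_one hζ1 hh)
  have := coeff_lt_one_of_natDegree_minpoly_eq hens hζ (E := K) rfl (hdeg.trans_lt hgdeg) hh1 hhζ i
  rw [← sub_add_cancel (g.coeff i : Ω) (algebraMap K Ω (h.coeff i))]
  exact ν.map_add_lt (hh i) this

/-- Over an immediate extension `F`, the value of a linear combination of powers of `ζ` is the
maximum of the values of its coefficients. -/
lemma exists_valuation_aeval_eq {ζ : Ω}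
    (hens : HenselianLocalRing (resVal K ν).valuationSubring) (hζ : HasDistinctResidues K ν ζ)
    (hF : IsImmediateExt K (resVal F ν)) {g : F[X]} (hg0 : g ≠ 0)
    (hgdeg : g.natDegree < (minpoly K ζ).natDegree) :
    ∃ i, g.coeff i ≠ 0 ∧ ν (aeval ζ g) = ν (g.coeff i) ∧
      ∀ j, ν (g.coeff j) ≤ ν (g.coeff i) := by
  obtain ⟨i, hi0, hmax⟩ := exists_coeff_max_valuation (resVal F ν) hg0
  have hvi0 : resVal F ν (g.coeff i) ≠ 0 := (Valuation.ne_zero_iff _).mpr hi0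
  refine ⟨i, hi0, ?_, hmax⟩
  have hζ1 : ν ζ ≤ 1 := hζ.le_one ζ (minpoly.aeval K ζ)
  -- Dividing by the largest coefficient gives an integral polynomial with a coefficient 1, which
  -- residual independence keeps from being small at ζ.
  set f : F[X] := C (g.coeff i)⁻¹ * g with hf
  have hfcoef : ∀ j, resVal F ν (f.coeff j) ≤ 1 := by
    intro j
    rw [hf, coeff_C_mul, map_mul, map_inv₀, inv_mul_le_iff₀ (zero_lt_iff.mpr hvi0), mul_one]
    exact hmax j
  have hfi : f.coeff i = 1 := by rw [hf, coeff_C_mul, inv_mul_cancel₀ hi0]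
  have hfdeg : f.natDegree < (minpoly K ζ).natDegree := (natDegree_C_mul_le _ _).trans_lt hgdeg
  have hfζ : ν (aeval ζ f) = 1 := by
    refine le_antisymm (valuation_aeval_le_one ν hζ1 hfcoef) (not_lt.mp fun h => ?_)
    have := coeff_lt_one_of_isImmediateExt hens hζ hF hfdeg hfcoef h i
    rw [hfi] at this
    simp at this
  have hgf : g = C (g.coeff i) * f := by
    rw [hf, ← mul_assoc, ← C_mul, mul_inv_cancel₀ hi0, C_1, one_mul]
  rw [hgf, map_mul, map_mul, hfζ, aeval_C, mul_one, ← hgf]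
  rfl

/-- A relation of smaller degree over F would vanish at ζ, whereas its value there is that of a
nonzero coefficient. -/
lemma natDegree_minpoly_of_isImmediateExt {ζ : Ω}
    (hens : HenselianLocalRing (resVal K ν).valuationSubring) (hζ : HasDistinctResidues K ν ζ)
    (hF : IsImmediateExt K (resVal F ν)) :
    (minpoly F ζ).natDegree = (minpoly K ζ).natDegree := by
  have hint : IsIntegral K ζ := hζ.separable.isIntegral
  have hdvd := minpoly.dvd_map_of_isScalarTower K F ζ
  refine le_antisymm ?_ (not_lt.mp fun hlt => ?_)
  · have := natDegree_le_of_dvd hdvd ((minpoly.monic hint).map _).ne_zero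
    rwa [natDegree_map] at this
  · obtain ⟨i, hi0, hi, -⟩ := exists_valuation_aeval_eq hens hζ hF
      (minpoly.ne_zero hint.tower_top) hlt
    rw [minpoly.aeval, map_zero, eq_comm, Valuation.zero_iff] at hi
    exact hi0 (Subtype.ext hi)

/-- Translating a generator of an immediate extension by an element generating an unramified
extension gives an immediate extension, provided that the degree does not grow. -/
theorem isImmediateExt_adjoin_add {ζ θ : Ω}
    (hens : HenselianLocalRing (resVal K ν).valuationSubring) (hζ : HasDistinctResidues K ν ζ)
    (hθ : IsImmediateExt K (resVal K⟮θ⟯ ν))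
    (hdeg : (minpoly K (θ + ζ)).natDegree ≤ (minpoly K θ).natDegree) :
    IsImmediateExt K (resVal K⟮θ + ζ⟯ ν) := by
  have : Algebra.IsAlgebraic K Ω := IsAlgClosure.isAlgebraic
  have hint : ∀ x : Ω, IsIntegral K x := Algebra.IsIntegral.isIntegral
  have hζ1 : ν ζ ≤ 1 := hζ.le_one ζ (minpoly.aeval K ζ)
  have hfin : ∀ x : Ω, FiniteDimensional K K⟮x⟯ := fun x => adjoin.finiteDimensional (hint x)
  have htower : ∀ x : Ω, Module.finrank K K⟮x⟯ * (minpoly K⟮x⟯ ζ).natDegree =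
      Module.finrank K K⟮x, ζ⟯ := by
    intro x
    have h := Module.finrank_mul_finrank K K⟮x⟯ K⟮x⟯⟮ζ⟯
    rw [adjoin.finrank (hint ζ).tower_top] at h
    rw [h, ← adjoin_simple_adjoin_simple]
    rfl
  have hpair : K⟮θ + ζ, ζ⟯ = K⟮θ, ζ⟯ := by
    apply le_antisymm
    · rw [adjoin_le_iff]
      rintro x (rfl | rfl)
      · exact add_mem (subset_adjoin _ _ (by simp)) (subset_adjoin _ _ (by simp))
      · exact subset_adjoin _ _ (by simp)
    · rw [adjoin_le_iff]
      have hmem : ζ ∈ K⟮θ + ζ, ζ⟯ := subset_adjoin _ _ (by simp)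
      rintro x (rfl | rfl)
      · have : x + ζ ∈ K⟮x + ζ, ζ⟯ := subset_adjoin _ _ (by simp)
        simpa using sub_mem this hmem
      · exact hmem
  have hdegθ := natDegree_minpoly_of_isImmediateExt hens hζ hθ
  -- Compute the degree of K(θ, ζ) = K(θ + ζ, ζ) along both towers: since θ + ζ has degree at most
  -- that of θ, ζ cannot lose degree over K(θ + ζ).
  have hdeg' : (minpoly K⟮θ + ζ⟯ ζ).natDegree = (minpoly K ζ).natDegree := by
    have hle : (minpoly K⟮θ + ζ⟯ ζ).natDegree ≤ (minpoly K ζ).natDegree := by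
      have := natDegree_le_of_dvd (minpoly.dvd_map_of_isScalarTower K K⟮θ + ζ⟯ ζ)
        ((minpoly.monic (hint ζ)).map _).ne_zero
      rwa [natDegree_map] at this
    have h1 := htower θ
    have h2 := htower (θ + ζ)
    rw [hpair, ← h1, hdegθ, adjoin.finrank (hint _), adjoin.finrank (hint _)] at h2
    have hpos : 0 < (minpoly K θ).natDegree := minpoly.natDegree_pos (hint θ)
    refine le_antisymm hle (le_of_mul_le_mul_left ?_ hpos)
    rw [← h2]
    exact Nat.mul_le_mul_right _ hdeg
  rw [isImmediateExt_intermediateField_iff]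
  intro y hy hy0
  have hexists : ∀ z ∈ K⟮θ + ζ⟯, ∃ g : K⟮θ⟯[X], g.natDegree < (minpoly K ζ).natDegree ∧
      z = aeval ζ g := by
    intro z hz
    have hz' : z ∈ K⟮θ⟯⟮ζ⟯ := by
      rw [← mem_restrictScalars K, adjoin_simple_adjoin_simple, ← hpair]
      exact adjoin.mono K _ _ (by simp) hz
    obtain ⟨g, hg, hgz⟩ := (adjoin.powerBasis (K := K⟮θ⟯) (hint ζ).tower_top).exists_eq_aeval
      ⟨z, hz'⟩
    refine ⟨g, hdegθ ▸ hg, ?_⟩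
    have h := congrArg (algebraMap K⟮θ⟯⟮ζ⟯ Ω) hgz
    rw [← aeval_algebraMap_apply] at h
    exact h
  obtain ⟨g, hgdeg, rfl⟩ := hexists y hy
  have hg0 : g ≠ 0 := fun h => hy0 (by rw [h, map_zero])
  obtain ⟨i, hi0, hi, -⟩ := exists_valuation_aeval_eq hens hζ hθ hg0 hgdeg
  -- The value of y is that of a coefficient in K(θ), hence of some element of K; dividing by it
  -- reduces to value one.
  obtain ⟨k₁, hk₁⟩ := (isImmediateExt_intermediateField_iff ν K⟮θ⟯).mp hθ (g.coeff i)
    (g.coeff i).2 fun h => hi0 (Subtype.ext h)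
  rw [Valuation.map_sub_swap] at hk₁
  have hk₁v : ν (algebraMap K Ω k₁) = ν (aeval ζ g) := (ν.map_eq_of_sub_lt hk₁).trans hi.symm
  have hy0' : ν (aeval ζ g) ≠ 0 := (Valuation.ne_zero_iff _).mpr hy0
  have hk₁0 : algebraMap K Ω k₁ ≠ 0 := by rw [← Valuation.ne_zero_iff ν, hk₁v]; exact hy0'
  set z : Ω := aeval ζ g / algebraMap K Ω k₁ with hz
  have hzv : ν z = 1 := by rw [hz, map_div₀, hk₁v, div_self hy0']
  have hz0 : z ≠ 0 := by rw [← Valuation.ne_zero_iff ν, hzv]; exact one_ne_zero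
  have hzmem : z ∈ K⟮θ + ζ⟯ := div_mem hy (IntermediateField.algebraMap_mem _ k₁)
  suffices h : ∃ k₀ : K, ν (z - algebraMap K Ω k₀) < 1 by
    obtain ⟨k₀, hk₀⟩ := h
    refine ⟨k₁ * k₀, ?_⟩
    have e : aeval ζ g - algebraMap K Ω (k₁ * k₀) =
        algebraMap K Ω k₁ * (z - algebraMap K Ω k₀) := by
      rw [map_mul, mul_sub, hz, mul_div_cancel₀ _ hk₁0]
    rw [e, map_mul, hk₁v]
    exact mul_lt_of_lt_one_right (zero_lt_iff.mpr hy0') hk₀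
  obtain ⟨f, hfdeg, hfz⟩ := hexists z hzmem
  have hf0 : f ≠ 0 := fun h => hz0 (by rw [hfz, h, map_zero])
  obtain ⟨j, -, hj, hjmax⟩ := exists_valuation_aeval_eq hens hζ hθ hf0 hfdeg
  rw [← hfz, hzv] at hj
  obtain ⟨h, hhdeg, hh1, hh⟩ := exists_polynomial_approx hθ (g := f) fun i => hj ▸ hjmax i
  refine ⟨h.coeff 0, ?_⟩
  have hsub := valuation_aeval_sub_lt_one hζ1 hh
  rw [← hfz] at hsub
  -- Now z - h(ζ) is small, with z a constant of K(θ + ζ) and h over K. Independence over K(θ + ζ)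
  -- makes every coefficient small, in particular z - h₀.
  have hlt := coeff_lt_one_of_natDegree_minpoly_eq hens hζ (E := K⟮θ + ζ⟯) hdeg'
    (g := C ⟨z, hzmem⟩ - h.map (algebraMap K K⟮θ + ζ⟯)) ?_ ?_ ?_ 0
  · rw [coeff_sub, coeff_C_zero, coeff_map, map_sub, ← IsScalarTower.algebraMap_apply] at hlt
    exact hlt
  · refine (natDegree_sub_le _ _).trans_lt (max_lt ?_ ?_)
    · rw [natDegree_C]
      exact minpoly.natDegree_pos (hint ζ)
    · rw [natDegree_map]
      exact hhdeg.trans_lt hfdeg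
  · intro i
    rw [coeff_sub, map_sub, coeff_map, ← IsScalarTower.algebraMap_apply]
    refine ν.map_sub_le ?_ (hh1 i)
    rw [coeff_C]
    split_ifs
    · exact hzv.le
    · simp
  · rw [map_sub, aeval_map_algebraMap, aeval_C]
    exact hsub

end ResidualRoots

/-! ### Additive polynomials: roots, separability, values -/

section AdditivePolynomial

variable {Ω Γ : Type*} [Field Ω] [LinearOrderedCommGroupWithZero Γ]

lemma eval_additivePoly {R : Type*} [CommRing R] (p n : ℕ) (a : ℕ → R) (x : R) :
    (additivePoly p n a).eval x = ∑ i ∈ Finset.range (n + 1), a i * x ^ p ^ i := by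
  simp [additivePoly, eval_finsetSum]

lemma map_additivePoly {R S : Type*} [CommRing R] [CommRing S] (f : R →+* S) (p n : ℕ)
    (a : ℕ → R) : (additivePoly p n a).map f = additivePoly p n (fun i => f (a i)) := by
  simp [additivePoly, Polynomial.map_sum]

lemma eval_additivePoly_add {R : Type*} [CommRing R] {p : ℕ} [Fact p.Prime] [CharP R p] (n : ℕ)
    (a : ℕ → R) (x y : R) : (additivePoly p n a).eval (x + y) =
      (additivePoly p n a).eval x + (additivePoly p n a).eval y := by
  simp only [eval_additivePoly, add_pow_char_pow, mul_add, Finset.sum_add_distrib]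

lemma eval_additivePoly_sub {R : Type*} [CommRing R] {p : ℕ} [Fact p.Prime] [CharP R p] (n : ℕ)
    (a : ℕ → R) (x y : R) : (additivePoly p n a).eval (x - y) =
      (additivePoly p n a).eval x - (additivePoly p n a).eval y := by
  rw [eq_sub_iff_add_eq, ← eval_additivePoly_add, sub_add_cancel]

lemma natDegree_additivePoly_sub_C {R : Type*} [CommRing R] {p : ℕ} (hp : p.Prime) {n : ℕ}
    {a : ℕ → R} (han : a n ≠ 0) (d : R) : (additivePoly p n a - C d).natDegree = p ^ n := by
  refine natDegree_eq_of_le_of_coeff_ne_zero ?_ ?_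
  · refine (natDegree_sub_le _ _).trans (max_le ?_ (by simp))
    refine natDegree_sum_le_of_forall_le _ _ fun i hi => ?_
    refine (natDegree_C_mul_X_pow_le _ _).trans ?_
    exact Nat.pow_le_pow_right hp.pos (Nat.lt_succ_iff.mp (Finset.mem_range.mp hi))
  · have hne : p ^ n ≠ 0 := pow_ne_zero _ hp.ne_zero
    rw [coeff_sub, coeff_C_of_ne_zero hne, sub_zero, additivePoly, finsetSum_coeff]
    simp only [coeff_C_mul_X_pow, (Nat.pow_right_injective hp.two_le).eq_iff]
    simpa using han

lemma separable_additivePoly_sub_C {k : Type*} [Field k] {p : ℕ} [CharP k p] (n : ℕ) {a : ℕ → k}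
    (ha₀ : a 0 ≠ 0) (d : k) : (additivePoly p n a - C d).Separable := by
  have hder : derivative (additivePoly p n a - C d) = C (a 0) := by
    rw [derivative_sub, derivative_C, sub_zero, additivePoly, derivative_sum,
      Finset.sum_eq_single_of_mem 0 (by simp)]
    · simp
    · intro i _ hi
      rw [derivative_C_mul_X_pow, Nat.cast_pow, CharP.cast_eq_zero, zero_pow hi]
      simp
  rw [Polynomial.Separable, hder]
  exact ⟨0, C (a 0)⁻¹, by rw [zero_mul, zero_add, ← C_mul, inv_mul_cancel₀ ha₀, C_1]⟩

/-- For x of value above one, the leading term strictly dominates. -/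
lemma valuation_le_one_of_eval_additivePoly (ν : Valuation Ω Γ) {p : ℕ} (hp : p.Prime) {n : ℕ}
    {e : ℕ → Ω} (he : ∀ i, ν (e i) ≤ 1) (hen : ν (e n) = 1) {x : Ω}
    (hx : ν ((additivePoly p n e).eval x) ≤ 1) : ν x ≤ 1 := by
  by_contra! h
  have hpn : 1 < ν (x ^ p ^ n) := by
    rw [map_pow]; exact one_lt_pow₀ h (pow_ne_zero _ hp.ne_zero)
  rw [eval_additivePoly, Finset.sum_range_succ, Valuation.map_add_eq_of_lt_right, map_mul, hen,
    one_mul] at hx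
  · exact absurd hx (not_le.mpr hpn)
  · rw [map_mul, hen, one_mul]
    refine ν.map_sum_lt (zero_lt_one.trans hpn).ne' fun i hi => ?_
    rw [map_mul, map_pow, map_pow]
    refine (mul_le_of_le_one_left' (he i)).trans_lt ?_
    exact pow_lt_pow_right₀ h (Nat.pow_lt_pow_right hp.one_lt (Finset.mem_range.mp hi))

/-- For nonzero x of value below one, the linear term strictly dominates, so no cancellation is
possible. -/
lemma one_le_valuation_of_eval_additivePoly_eq_zero (ν : Valuation Ω Γ) {p : ℕ} (hp : p.Prime)
    {n : ℕ} {e : ℕ → Ω} (he : ∀ i, ν (e i) ≤ 1) (he₀ : ν (e 0) = 1) {x : Ω} (hx0 : x ≠ 0)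
    (hx : (additivePoly p n e).eval x = 0) : 1 ≤ ν x := by
  by_contra! h
  have hνx : 0 < ν x := zero_lt_iff.mpr ((Valuation.ne_zero_iff ν).mpr hx0)
  rw [eval_additivePoly, Finset.sum_range_succ'] at hx
  have hlt : ν (∑ i ∈ Finset.range n, e (i + 1) * x ^ p ^ (i + 1)) < ν (e 0 * x ^ p ^ 0) := by
    rw [map_mul, he₀, one_mul, pow_zero, pow_one]
    refine ν.map_sum_lt hνx.ne' fun i _ => ?_
    rw [map_mul, map_pow]
    refine (mul_le_of_le_one_left' (he _)).trans_lt ?_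
    exact pow_lt_self_of_lt_one₀ hνx h (Nat.one_lt_pow (Nat.succ_ne_zero i) hp.one_lt)
  have := ν.map_add_eq_of_lt_right hlt
  rw [hx, map_zero, map_mul, he₀, one_mul, pow_zero, pow_one] at this
  exact hνx.ne this

lemma valuation_eval_additivePoly_lt_one (ν : Valuation Ω Γ) {p : ℕ} (hp : p.Prime) {n : ℕ}
    {e : ℕ → Ω} (he : ∀ i, ν (e i) ≤ 1) {x : Ω} (hx : ν x < 1) :
    ν ((additivePoly p n e).eval x) < 1 := by
  rw [eval_additivePoly]
  refine ν.map_sum_lt one_ne_zero fun i _ => ?_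
  rw [map_mul, map_pow]
  exact (mul_le_of_le_one_left' (he _)).trans_lt (pow_lt_one₀ zero_le hx (pow_ne_zero _ hp.ne_zero))

end AdditivePolynomial

/-! ### Solutions of 𝔄(x) = b in valued extensions -/

section

variable {p : ℕ} {K Ω Γ : Type*} [Field K] [Field Ω] [Algebra K Ω]
  [LinearOrderedCommGroupWithZero Γ]

lemma aeval_additivePoly_sub_C (n : ℕ) (a : ℕ → K) (d : K) (x : Ω) :
    aeval x (additivePoly p n a - C d) =
      (additivePoly p n fun i => algebraMap K Ω (a i)).eval x - algebraMap K Ω d := by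
  rw [map_sub, aeval_C, ← eval_map_algebraMap, map_additivePoly]

/-- The difference of two distinct conjugates is a nonzero root of 𝔄, so it cannot be small since a₀
is a unit. -/
lemma hasDistinctResidues_of_eval_additivePoly [CharP K p] (hp : p.Prime) (ν : Valuation Ω Γ)
    {n : ℕ} {a : ℕ → K} (ha : ∀ i, resVal K ν (a i) ≤ 1) (ha₀ : resVal K ν (a 0) = 1)
    (han : resVal K ν (a n) = 1) {b : K} (hb : resVal K ν b ≤ 1) {ζ : Ω}
    (hζ : aeval ζ (additivePoly p n a - C b) = 0) : HasDistinctResidues K ν ζ := by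
  have : Fact p.Prime := ⟨hp⟩
  have : CharP Ω p := charP_of_injective_algebraMap (algebraMap K Ω).injective p
  have hdvd := minpoly.dvd K ζ hζ
  have hroot : ∀ r : Ω, aeval r (minpoly K ζ) = 0 →
      (additivePoly p n fun i => algebraMap K Ω (a i)).eval r = algebraMap K Ω b := by
    intro r hr
    rw [← sub_eq_zero, ← aeval_additivePoly_sub_C]
    exact aeval_eq_zero_of_dvd_aeval_eq_zero hdvd hr
  have ha₀' : a 0 ≠ 0 := by
    rw [← Valuation.ne_zero_iff (resVal K ν), ha₀]; exact one_ne_zero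
  refine ⟨(separable_additivePoly_sub_C n ha₀' b).of_dvd hdvd, fun r hr => ?_,
    fun r s hr hs hne => ?_⟩
  · refine valuation_le_one_of_eval_additivePoly ν hp ha han ?_
    rw [hroot r hr]
    exact hb
  · refine one_le_valuation_of_eval_additivePoly_eq_zero ν hp (n := n) ha ha₀ (sub_ne_zero.mpr hne) ?_
    rw [eval_additivePoly_sub, hroot r hr, hroot s hs, sub_self]

/-- An immediate extension contains no solution of `𝔄(x) = b` if the reduction of `𝔄` does not take
the value of the residue of `b`. -/
lemma eval_additivePoly_ne_of_isImmediateExt [CharP K p] (hp : p.Prime) (ν : Valuation Ω Γ) {n : ℕ}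
    {a : ℕ → (resVal K ν).valuationSubring} (han : resVal K ν (a n : K) = 1)
    {b : (resVal K ν).valuationSubring}
    (hb : ∀ r, ((additivePoly p n a).map (residue (resVal K ν).valuationSubring)).eval r ≠
      residue _ b)
    {W : IntermediateField K Ω} (hW : IsImmediateExt K (resVal W ν)) {x : Ω} (hx : x ∈ W) :
    (additivePoly p n fun i => algebraMap K Ω (a i : K)).eval x ≠ algebraMap K Ω (b : K) := by
  intro hxb
  have : Fact p.Prime := ⟨hp⟩
  have : CharP Ω p := charP_of_injective_algebraMap (algebraMap K Ω).injective p
  have hx1 : ν x ≤ 1 := valuation_le_one_of_eval_additivePoly ν hp (fun i => (a i).2) han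
    (by rw [hxb]; exact b.2)
  obtain ⟨k, hk1, hk⟩ := exists_integral_approx hW ⟨x, hx⟩ hx1
  have hlt := valuation_eval_additivePoly_lt_one ν hp (n := n)
    (e := fun i => algebraMap K Ω (a i : K)) (fun i => (a i).2) hk
  rw [eval_additivePoly_sub, hxb] at hlt
  refine hb (residue _ ⟨k, hk1⟩) ?_
  rw [eval_map_apply, eq_comm, ← sub_eq_zero, ← map_sub, residue_eq_zero_iff,
    Valuation.mem_maximalIdeal_iff]
  change ν (algebraMap K Ω _) < 1
  convert hlt using 2
  simp [eval_additivePoly]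

end

theorem theorem3p6 {p : ℕ} (hp : p.Prime) {K Ω Γ : Type*} [Field K] [CharP K p]
    [Field Ω] [Algebra K Ω] [IsAlgClosure K Ω] [LinearOrderedCommGroupWithZero Γ]
    -- the valuation on the algebraic closure `Ω` of `K`; its restriction to `K` is henselian
    (ν : Valuation Ω Γ) (hens : HenselianLocalRing (resVal K ν).valuationSubring)
    (θ : Ω) (hwild : IsMinimalPurelyWild p ν K⟮θ⟯)
    -- the minimal polynomial of `θ` over `K` is `𝔄(X) - c`, up to a nonzero constant factor
    (n : ℕ) (a : ℕ → (resVal K ν).valuationSubring) (c : K)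
    (hmin : Associated (minpoly K θ)
      ((additivePoly p n a).map (algebraMap (resVal K ν).valuationSubring K) - C c))
    (ha₀ : resVal K ν (a 0 : K) = 1) (han : resVal K ν (a n : K) = 1)
    (hclosed : ¬ IsPolyClosed ((additivePoly p n a).map (residue (resVal K ν).valuationSubring)))
    (himm : IsMinimalImmediate ν K⟮θ⟯) :
    ∃ W₁ W₂ : IntermediateField K Ω,
      IsMaximalImmediateAlg ν W₁ ∧ IsMaximalImmediateAlg ν W₂ ∧ IsEmpty (W₁ ≃ₐ[K] W₂) := by
  have : Fact p.Prime := ⟨hp⟩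
  have : CharP Ω p := charP_of_injective_algebraMap (algebraMap K Ω).injective p
  have : IsAlgClosed Ω := IsAlgClosure.isAlgClosed K
  have : Algebra.IsAlgebraic K Ω := IsAlgClosure.isAlgebraic
  obtain ⟨r, hr⟩ := not_forall.mp hclosed
  obtain ⟨b, rfl⟩ := residue_surjective r
  replace hr := fun x h => hr ⟨x, h⟩
  rw [map_additivePoly] at hmin
  set a' : ℕ → K := fun i => (a i : K)
  have hmin' : Associated (minpoly K θ) (additivePoly p n a' - C c) := hmin
  have han0 : a' n ≠ 0 := by
    rw [← Valuation.ne_zero_iff (resVal K ν), han]; exact one_ne_zero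
  have hnd : ∀ d : K, (additivePoly p n a' - C d).natDegree = p ^ n :=
    natDegree_additivePoly_sub_C hp han0
  have hne : ∀ d : K, additivePoly p n a' - C d ≠ 0 := fun d h => by
    have := hnd d
    rw [h, natDegree_zero] at this
    exact pow_ne_zero n hp.ne_zero this.symm
  obtain ⟨ζ, hζ⟩ := IsAlgClosed.exists_aeval_eq_zero Ω (additivePoly p n a' - C (b : K))
    (fun h => pow_ne_zero n hp.ne_zero (by rw [← hnd (b : K), natDegree_eq_zero_iff_degree_le_zero.mpr h.le]))
  have hθ : aeval θ (additivePoly p n a' - C c) = 0 :=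
    aeval_eq_zero_of_dvd_aeval_eq_zero hmin'.dvd (minpoly.aeval K θ)
  have hθζ : aeval (θ + ζ) (additivePoly p n a' - C (c + b)) = 0 := by
    rw [aeval_additivePoly_sub_C, sub_eq_zero] at hζ hθ ⊢
    rw [eval_additivePoly_add, hζ, hθ, map_add]
  have himm' : IsImmediateExt K (resVal K⟮θ + ζ⟯ ν) := by
    refine isImmediateExt_adjoin_add hens
      (hasDistinctResidues_of_eval_additivePoly hp ν (fun i => (a i).2) ha₀ han b.2 hζ) himm.1 ?_
    -- Irreducibility of 𝔄(X) - (c + b) is not needed: an upper bound for the degree of θ + ζ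
    -- suffices.
    calc (minpoly K (θ + ζ)).natDegree ≤ (additivePoly p n a' - C (c + b)).natDegree :=
          natDegree_le_of_dvd (minpoly.dvd K _ hθζ) (hne _)
      _ = (additivePoly p n a' - C c).natDegree := by rw [hnd, hnd]
      _ ≤ (minpoly K θ).natDegree :=
          natDegree_le_of_dvd hmin'.symm.dvd (minpoly.ne_zero (Algebra.IsIntegral.isIntegral θ))
  obtain ⟨W₁, hθW, hW₁⟩ := exists_isMaximalImmediateAlg_ge ν _ himm.1
  obtain ⟨W₂, hθζW, hW₂⟩ := exists_isMaximalImmediateAlg_ge ν _ himm'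
  refine ⟨W₁, W₂, hW₁, hW₂, ⟨fun φ => ?_⟩⟩
  -- The transported root η need not be θ + ζ itself, but η - θ still solves 𝔄(x) = b within W₁.
  let η : W₁ := φ.symm ⟨θ + ζ, hθζW (mem_adjoin_simple_self K _)⟩
  have hη : aeval (η : Ω) (additivePoly p n a' - C (c + b)) = 0 := by
    have h : aeval ((W₁.val.comp φ.symm.toAlgHom)
        (⟨θ + ζ, hθζW (mem_adjoin_simple_self K _)⟩ : W₂))
        (additivePoly p n a' - C (c + b)) = 0 := by
      rw [aeval_algHom_apply]
      have h2 : aeval (⟨θ + ζ, hθζW (mem_adjoin_simple_self K _)⟩ : W₂)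
          (additivePoly p n a' - C (c + b)) = 0 := by
        apply (algebraMap W₂ Ω).injective
        rw [← aeval_algebraMap_apply, map_zero]
        exact hθζ
      rw [h2, map_zero]
    exact h
  refine eval_additivePoly_ne_of_isImmediateExt hp ν han hr hW₁.1
    (sub_mem η.2 (hθW (mem_adjoin_simple_self K θ))) ?_
  rw [aeval_additivePoly_sub_C, sub_eq_zero] at hη hθ
  change (additivePoly p n fun i => algebraMap K Ω (a' i)).eval _ = _
  rw [eval_additivePoly_sub, hη, hθ, map_add, add_sub_cancel_left]
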